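/- For a partially ordered set $P$, a topological space $Z$ has a \emph{$P$-base} if every point $z\in Z$ has a neighborhood base $(U_p[z])_{p\in P}$ such that $U_p[z]\subseteq U_{p'}[z]$ whenever $p\ge p'$ in $P$. For a topological space $Z$, the \emph{free Abelian topological group} $A(Z)$ is the free Abelian group on the set $Z$ with the finest group topology for which the canonical map $Z\to A(Z)$ is continuous; equivalently, every continuous map from $Z$ to an Abelian topological group extends uniquely to a continuous homomorphism on $A(Z)$. (If $Z$ is Tychonoff, $A(Z)$ is Hausdorff.) For a subset $Y$ of a topological space $X$, $X/Y$ denotes the quotient space of $X$ obtained by identifying all points of $Y$ with each other, with the quotient topology. \textbf{Theorem.} Let $X$ be a Tychonoff space, $Y$ a closed subspace of $X$, and $P$ a partially ordered set. If $A(X)$ has a $P$-base, then $A(X/Y)$ also has a $P$-base. -/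

import Mathlib

open Topology

/-- `HasPBase P Z`: the topological space `Z` has a `P`-base, i.e. every point `z` has a
neighborhood base `(U p)` indexed by the poset `P` with `U p ⊆ U p'` whenever `p' ≤ p`. -/
def HasPBase (P : Type*) [PartialOrder P] (Z : Type*) [TopologicalSpace Z] : Prop :=
  ∀ z : Z, ∃ U : P → Set Z, (𝓝 z).HasBasis (fun _ => True) U ∧
    ∀ p p' : P, p' ≤ p → U p ⊆ U p'

/-- The relation on `X` identifying all points of `Y` with each other, and nothing else. -/
def collapseSetoid {X : Type*} (Y : Set X) : Setoid X where
  r x y := x = y ∨ (x ∈ Y ∧ y ∈ Y)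
  iseqv :=
    { refl := fun _ => Or.inl rfl
      symm := by
        rintro x y (h | ⟨hx, hy⟩)
        · exact Or.inl h.symm
        · exact Or.inr ⟨hy, hx⟩
      trans := by
        rintro x y z (rfl | ⟨hx, hy⟩) h
        · exact h
        · rcases h with rfl | ⟨_, hz⟩
          · exact Or.inr ⟨hx, hy⟩
          · exact Or.inr ⟨hx, hz⟩ }

/-- The space `X/Y`; its topology is Mathlib's quotient topology. -/
abbrev CollapseQuotient {X : Type*} (Y : Set X) : Type _ :=
  Quotient (collapseSetoid Y)

/-- The free Abelian topological group `A(X)`: the free Abelian group on the set `X`, to be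
equipped with the finest group topology for which the insertion of generators is continuous. -/
def FreeAbelianTopGroup (X : Type*) : Type _ := FreeAbelianGroup X

namespace FreeAbelianTopGroup

instance (X : Type*) : AddCommGroup (FreeAbelianTopGroup X) :=
  inferInstanceAs (AddCommGroup (FreeAbelianGroup X))

/-- The canonical map `σ : X → A(X)`. -/
def of {X : Type*} (x : X) : FreeAbelianTopGroup X := FreeAbelianGroup.of x

/-- `AddGroupTopology.coinduced f` is the finest group topology making `f` continuous. -/
instance (X : Type*) [TopologicalSpace X] : TopologicalSpace (FreeAbelianTopGroup X) :=
  (AddGroupTopology.coinduced (of : X → FreeAbelianTopGroup X)).toTopologicalSpace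

instance (X : Type*) [TopologicalSpace X] : IsTopologicalAddGroup (FreeAbelianTopGroup X) :=
  (AddGroupTopology.coinduced (of : X → FreeAbelianTopGroup X)).toIsTopologicalAddGroup

theorem continuous_of (X : Type*) [TopologicalSpace X] :
    Continuous (of : X → FreeAbelianTopGroup X) :=
  AddGroupTopology.coinduced_continuous _

/-- The image of `X` generates `A(X)`. -/
theorem closure_range_of (X : Type*) :
    AddSubgroup.closure (Set.range (of : X → FreeAbelianTopGroup X)) = ⊤ := by
  refine eq_top_iff.2 fun a _ => ?_
  refine FreeAbelianGroup.induction_on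
    (motive := fun a : FreeAbelianTopGroup X => a ∈ AddSubgroup.closure (Set.range of)) a
    (zero_mem _) (fun x => AddSubgroup.subset_closure ⟨x, rfl⟩)
    (fun _ h => neg_mem h) (fun _ _ h h' => add_mem h h')

/-- The universal property of `A(X)`: a continuous map into an Abelian topological group
extends uniquely to a continuous homomorphism. -/
theorem existsUnique_lift {X H : Type*} [TopologicalSpace X] [AddCommGroup H]
    [TopologicalSpace H] [IsTopologicalAddGroup H] (f : X → H) (hf : Continuous f) :
    ∃! g : FreeAbelianTopGroup X →+ H, Continuous g ∧ ∀ x, g (of x) = f x := by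
  let g : FreeAbelianTopGroup X →+ H := FreeAbelianGroup.lift f
  have hg : ∀ x, g (of x) = f x := fun x => FreeAbelianGroup.lift_apply_of f x
  refine ⟨g, ⟨?_, hg⟩, fun g' h => ?_⟩
  · let t : AddGroupTopology (FreeAbelianTopGroup X) :=
      { toTopologicalSpace := TopologicalSpace.induced g inferInstance
        toIsTopologicalAddGroup := topologicalAddGroup_induced g }
    have ht : AddGroupTopology.coinduced (of : X → FreeAbelianTopGroup X) ≤ t := by
      refine sInf_le ?_
      refine continuous_iff_coinduced_le.1 (continuous_induced_rng.2 ?_)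
      exact hf.congr fun x => (hg x).symm
    exact continuous_iff_le_induced.2 ht
  · exact FreeAbelianGroup.lift_ext g' g fun x => (h.2 x).trans (hg x).symm

/-- For Tychonoff `X` the group `A(X)` is Hausdorff. -/
theorem t2Space (X : Type*) [TopologicalSpace X] [T35Space X] :
    T2Space (FreeAbelianTopGroup X) := by
  classical
  suffices h : T1Space (FreeAbelianTopGroup X) by infer_instance
  refine IsTopologicalAddGroup.t1Space _ ?_
  rw [← isOpen_compl_iff, isOpen_iff_forall_mem_open]
  intro a ha
  obtain ⟨x, hx⟩ : (FreeAbelianGroup.support (X := X) a).Nonempty := by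
    rw [Finset.nonempty_iff_ne_empty]
    intro h
    apply ha
    have : FreeAbelianGroup.toFinsupp (X := X) a = 0 := Finsupp.support_eq_empty.1 h
    exact (FreeAbelianGroup.equivFinsupp X).map_eq_zero_iff.1 this
  have hK : IsClosed ((FreeAbelianGroup.support (X := X) a : Set X) \ {x}) :=
    ((FreeAbelianGroup.support (X := X) a).finite_toSet.subset Set.sdiff_subset).isClosed
  obtain ⟨f, hf, hfx, hfK⟩ := CompletelyRegularSpace.completely_regular x _ hK (by simp)
  obtain ⟨g, ⟨hg, hgf⟩, -⟩ := existsUnique_lift (fun y => 1 - (f y : ℝ)) (by fun_prop)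
  refine ⟨g ⁻¹' {0}ᶜ, fun b hb h0 => hb ?_, isOpen_compl_singleton.preimage hg, ?_⟩
  · rw [Set.mem_singleton_iff.1 h0]
    simp
  · have key : g a = (FreeAbelianGroup.coeff x a : ℝ) := by
      have h1 : ∀ b : FreeAbelianTopGroup X,
          g b = (FreeAbelianGroup.toFinsupp (X := X) b).sum
            fun y n => (n : ℝ) * (1 - (f y : ℝ)) := by
        intro b
        refine FreeAbelianGroup.induction_on (motive := fun b : FreeAbelianTopGroup X =>
          g b = (FreeAbelianGroup.toFinsupp (X := X) b).sum
            fun y n => (n : ℝ) * (1 - (f y : ℝ))) b ?_ ?_ ?_ ?_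
        · exact (map_zero g).trans (by simp)
        · intro y
          exact (hgf y).trans (by simp)
        · intro y _
          refine (map_neg g (of y)).trans ?_
          rw [hgf, map_neg, FreeAbelianGroup.toFinsupp_of, Finsupp.sum_neg_index] <;> simp
        · intro b c hb hc
          refine (map_add g b c).trans ?_
          refine (congrArg₂ (· + ·) hb hc).trans ?_
          rw [map_add, Finsupp.sum_add_index'] <;> simp [add_mul]
      rw [h1, Finsupp.sum, Finset.sum_eq_single x]
      · simp [hfx, FreeAbelianGroup.coeff]
        rfl
      · intro y hy hyx
        have := hfK ⟨hy, hyx⟩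
        simp [this]
      · intro h
        exact absurd hx h
    rw [Set.mem_preimage, key]
    simpa using (FreeAbelianGroup.mem_support_iff x a).1 hx

end FreeAbelianTopGroup

/-! Open continuous surjections carry a neighborhood base at a point to one at its image and
preserve inclusions, so it suffices that a quotient map `q : X → Z` induces an open surjection `φ :
A(X) → A(Z)`. The universal property of `A(Z)` gives a continuous homomorphism from `A(Z)` to
`A(X)/ker φ` inverting the bijection induced by `φ`. Openness of `φ` thus reduces to that of the
projection onto `A(X)/ker φ`. -/

/-- A surjective open continuous map transports `P`-bases. -/
theorem HasPBase.of_isOpenMap {P : Type*} [PartialOrder P] {Z W : Type*} [TopologicalSpace Z]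
    [TopologicalSpace W] {f : Z → W} (hZ : HasPBase P Z) (hf : Continuous f) (ho : IsOpenMap f)
    (hs : Function.Surjective f) : HasPBase P W := by
  intro w
  obtain ⟨z, rfl⟩ := hs w
  obtain ⟨U, hU, hmono⟩ := hZ z
  refine ⟨fun p => f '' U p, ?_, fun p p' h => Set.image_mono (hmono p p' h)⟩
  rw [← ho.map_nhds_eq hf.continuousAt]
  exact hU.map f

namespace FreeAbelianTopGroup

/-- A quotient map of spaces induces an open continuous surjective homomorphism of the free Abelian
topological groups. -/
theorem exists_isOpenQuotientMap {X Z : Type*} [TopologicalSpace X] [TopologicalSpace Z]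
    {q : X → Z} (hq : IsQuotientMap q) :
    ∃ φ : FreeAbelianTopGroup X →+ FreeAbelianTopGroup Z,
      (∀ x, φ (of x) = of (q x)) ∧ IsOpenQuotientMap φ := by
  obtain ⟨φ, ⟨hφ, hφq⟩, -⟩ := existsUnique_lift _ ((continuous_of Z).comp hq.continuous)
  have hsurj : Function.Surjective φ := by
    rw [← AddMonoidHom.range_eq_top, eq_top_iff, ← closure_range_of Z, AddSubgroup.closure_le]
    rintro _ ⟨z, rfl⟩
    obtain ⟨x, rfl⟩ := hq.surjective z
    exact ⟨of x, hφq x⟩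
  -- The chosen preimage is irrelevant: generators over the same point of `Z` differ by an element
  -- of `ker φ`.
  let f : Z → FreeAbelianTopGroup X ⧸ φ.ker := fun z =>
    QuotientAddGroup.mk (of (Function.surjInv hq.surjective z))
  have hfq : ∀ x, f (q x) = QuotientAddGroup.mk (of x) := fun x => by
    refine QuotientAddGroup.eq.2 ?_
    rw [AddMonoidHom.mem_ker, map_add, map_neg, hφq, hφq]
    simp [Function.surjInv_eq]
  -- The only use of the quotient topology on `Z`: continuity of `f` can be tested after composing
  -- with `q`.
  have hf : Continuous f := by
    rw [hq.continuous_iff]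
    exact (continuous_quotient_mk'.comp (continuous_of X)).congr fun x => (hfq x).symm
  obtain ⟨s, ⟨hs, hsf⟩, -⟩ := existsUnique_lift f hf
  have hsφ : ∀ a, s (φ a) = QuotientAddGroup.mk a := fun a => by
    have h : s.comp φ = QuotientAddGroup.mk' φ.ker := by
      refine AddMonoidHom.eq_of_eqOn_dense (closure_range_of X) ?_
      rintro _ ⟨x, rfl⟩
      exact ((congrArg s (hφq x)).trans (hsf (q x))).trans (hfq x)
    exact DFunLike.congr_fun h a
  refine ⟨φ, hφq, hsurj, hφ, fun V hV => ?_⟩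
  -- Since `s (φ a)` is the class of `a`, both sides say that `a` agrees with some `v ∈ V` modulo
  -- `ker φ`.
  have himage : φ '' V = s ⁻¹' (QuotientAddGroup.mk '' V) := by
    ext b
    obtain ⟨a, rfl⟩ := hsurj b
    rw [Set.mem_preimage, hsφ]
    refine exists_congr fun v => and_congr_right fun _ => ?_
    rw [QuotientAddGroup.eq, AddMonoidHom.mem_ker, map_add, map_neg, neg_add_eq_zero]
  rw [himage]
  exact (QuotientAddGroup.isOpenMap_coe V hV).preimage hs

end FreeAbelianTopGroup

theorem mainTheorem4 {X : Type*} [TopologicalSpace X] [T35Space X] (Y : Set X)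
    (hY : IsClosed Y) (P : Type*) [PartialOrder P]
    (hX : HasPBase P (FreeAbelianTopGroup X)) :
    HasPBase P (FreeAbelianTopGroup (CollapseQuotient Y)) := by
  obtain ⟨φ, -, hφ⟩ := FreeAbelianTopGroup.exists_isOpenQuotientMap
    (isQuotientMap_quotient_mk' (s := collapseSetoid Y))
  exact hX.of_isOpenMap hφ.continuous hφ.isOpenMap hφ.surjective
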